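/- Let $\mathbb{H}=\{z\in\mathbb{C}:\operatorname{Im} z>0\}$ with the pseudo-hyperbolic distance $d(z,w)=\left|\frac{w-z}{w-\overline{z}}\right|$. Let $\phi:\mathbb{H}\to\mathbb{H}$ be analytic and of parabolic type with Denjoy–Wolff point $\infty$, i.e. $\phi(z)\to\infty$ and $\phi(z)/z\to 1$ as $z\to\infty$ in each sector $\{|\operatorname{Arg} z-\pi/2|<\theta\}$, $0<\theta<\pi/2$. Let $w_n=x_n+iy_n$ and $\tilde w_n=\tilde x_n+i\tilde y_n$ $(n\ge 0)$ be two sequences in $\mathbb{H}$ with $\phi(w_{n+1})=w_n$ and $\phi(\tilde w_{n+1})=\tilde w_n$ for all $n$, both tending to $\infty$ with arguments tending to $0$, with steps bounded away from $1$, \[ d(w_n,w_{n+1})\uparrow a<1,\qquad d(\tilde w_n,\tilde w_{n+1})\uparrow\tilde a<1, \] and of non-zero height: $y_n\downarrow\ell_\infty>0$, $\tilde y_n\downarrow\tilde\ell_\infty>0$. Put $b_0=\frac{2a}{\sqrt{1-a^2}}$, $\tilde b_0=\frac{2\tilde a}{\sqrt{1-\tilde a^2}}$; these are positive. Let $\tau_n(z)=x_n+y_nz$,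 $\tilde\tau_n(z)=\tilde x_n+\tilde y_nz$, and let $\phi_n$ denote the $n$-th iterate of $\phi$. Then the sequences $\phi_n\circ\tau_n$ and $\phi_n\circ\tilde\tau_n$ converge uniformly on compact subsets of $\mathbb{H}$ to analytic self-maps $\psi$ and $\tilde\psi$ of $\mathbb{H}$ satisfying $\psi(z-b_0)=\phi(\psi(z))$ and $\tilde\psi(z-\tilde b_0)=\phi(\tilde\psi(z))$ for $z\in\mathbb{H}$, and there is $b_1\in\mathbb{R}$ such that \[ \tilde\psi\Big(\frac{\tilde b_0}{b_0}z+b_1\Big)=\psi(z)\qquad(z\in\mathbb{H}). \] Moreover, for this $b_1$ and $z_1=\frac{b_0}{\tilde b_0}(i-b_1)$, one has $\tilde w_n=\psi(z_1+nb_0)$ for all $n\ge 0$. Finally, \[ \lim_{n\to\infty}(x_{n+1}-x_n)=\ell_\infty b_0=\tilde\ell_\infty\tilde b_0=\lim_{n\to\infty}(\tilde x_{n+1}-\tilde x_n). \] -/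

import Mathlib

open Filter Topology

/-- The open upper half-plane, as a subset of the complex plane. -/
def upperHalf : Set ℂ := {z : ℂ | 0 < z.im}

/-- The pseudo-hyperbolic distance `|w - z| / |w - conj z|` of the upper half-plane. -/
noncomputable def pseudoHypDist (z w : ℂ) : ℝ :=
  ‖(w - z) / (w - (starRingEnd ℂ) z)‖

/-- The sector `{|Arg z - π/2| < θ}`; for `0 < θ < π/2` these are the non-tangential approach
regions at infinity in the upper half-plane. -/
def sectorAtInfty (θ : ℝ) : Set ℂ := {z : ℂ | |z.arg - Real.pi / 2| < θ}

/-- `f` tends to `l` as `z` tends to infinity non-tangentially in the upper half-plane. -/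
def TendstoNontangentially (f : ℂ → ℂ) (l : Filter ℂ) : Prop :=
  ∀ θ : ℝ, 0 < θ → θ < Real.pi / 2 →
    Tendsto f (Bornology.cobounded ℂ ⊓ 𝓟 (sectorAtInfty θ)) l

/-- An analytic self-map of the upper half-plane of parabolic type whose Denjoy-Wolff point is
infinity: `φ z → ∞` and `φ z / z → 1` as `z → ∞` non-tangentially. Only the values of `φ` on
the upper half-plane matter. -/
structure IsParabolicSelfMap (φ : ℂ → ℂ) : Prop where
  differentiableOn : DifferentiableOn ℂ φ upperHalf
  mapsTo : Set.MapsTo φ upperHalf upperHalf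
  tendsto_infty : TendstoNontangentially φ (Bornology.cobounded ℂ)
  tendsto_div : TendstoNontangentially (fun z => φ z / z) (𝓝 1)

/-- A backward-iteration sequence with bounded (pseudo-hyperbolic) steps for `φ`. -/
structure IsBISBS (φ : ℂ → ℂ) (w : ℕ → ℂ) : Prop where
  mem : ∀ n, w n ∈ upperHalf
  map_succ : ∀ n, φ (w (n + 1)) = w n
  bounded_steps : ∃ c : ℝ, c < 1 ∧ ∀ n, pseudoHypDist (w n) (w (n + 1)) ≤ c

/-- A backward-iteration sequence with bounded steps which tends to infinity with argument tending
to `0`, whose steps tend to `a` and whose imaginary parts tend to `ℓ > 0`. -/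
structure IsNonzeroHeightBISBS (φ : ℂ → ℂ) (w : ℕ → ℂ) (a ℓ : ℝ) : Prop extends IsBISBS φ w where
  tendsto_infty : Tendsto w atTop (Bornology.cobounded ℂ)
  tendsto_arg : Tendsto (fun n => (w n).arg) atTop (𝓝 0)
  tendsto_step : Tendsto (fun n => pseudoHypDist (w n) (w (n + 1))) atTop (𝓝 a)
  tendsto_im : Tendsto (fun n => (w n).im) atTop (𝓝 ℓ)
  height_pos : 0 < ℓ

/-- The translation length `b₀ = 2a / √(1 - a²)` attached to the limit step `a`. -/
noncomputable def translationLength (a : ℝ) : ℝ := 2 * a / Real.sqrt (1 - a ^ 2)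

/-- The automorphism `τ(z) = x + y z` of the upper half-plane, where `p = x + i y`. -/
noncomputable def affineAt (p z : ℂ) : ℂ := (p.re : ℂ) + (p.im : ℂ) * z

/-- `ψ` is the conjugation attached to the backward-iteration sequence `w` of `φ`: the
normalized iterates `φ ∘ ⋯ ∘ φ ∘ τₙ` (`n` copies of `φ`, `τₙ(z) = xₙ + yₙ z`) converge to `ψ`
uniformly on the compact subsets of the upper half-plane, `ψ` is an analytic self-map of the
upper half-plane, and `ψ (z - b) = φ (ψ z)`. -/
structure IsConjugation (φ : ℂ → ℂ) (w : ℕ → ℂ) (b : ℝ) (ψ : ℂ → ℂ) : Prop where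
  differentiableOn : DifferentiableOn ℂ ψ upperHalf
  mapsTo : Set.MapsTo ψ upperHalf upperHalf
  tendsto_compact : ∀ K : Set ℂ, K ⊆ upperHalf → IsCompact K →
    TendstoUniformlyOn (fun (n : ℕ) (z : ℂ) => φ^[n] (affineAt (w n) z)) ψ atTop K
  conj : ∀ z ∈ upperHalf, ψ (z - (b : ℂ)) = φ (ψ z)

/-!
By Julia's lemma `φ` does not decrease imaginary parts, so the displacement `φ z - z` takes values
in the closed upper half-plane, and the Schwarz-Pick lemma bounds its variation between points at
bounded hyperbolic distance by a multiple of `Im (φ z) - Im z`. Along a backward orbit these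
increments of height telescope to a finite sum. Hence the Euclidean steps `w (n + 1) - w n`
converge, the normalized iterates are uniformly Cauchy on compact sets, and the difference of two
backward orbits converges after a shift of indices. So the normalizations of the two orbits differ
in the limit by a real affine map, which relates their conjugations.
-/

open scoped ComplexConjugate

lemma isOpen_upperHalf : IsOpen upperHalf := isOpen_lt continuous_const Complex.continuous_im

section PseudoHyperbolic

variable {z w : ℂ} {r : ℝ}

lemma norm_sub_conj_sq (z w : ℂ) :
    ‖w - conj z‖ ^ 2 = ‖w - z‖ ^ 2 + 4 * z.im * w.im := by
  simp only [Complex.sq_norm, Complex.normSq_apply, Complex.sub_re, Complex.sub_im,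
    Complex.conj_re, Complex.conj_im]
  ring

lemma mem_upperHalf_iff_norm_sub_lt (hz : z ∈ upperHalf) :
    w ∈ upperHalf ↔ ‖w - z‖ < ‖w - conj z‖ := by
  have hz' : 0 < z.im := hz
  rw [← sq_lt_sq₀ (norm_nonneg _) (norm_nonneg _), norm_sub_conj_sq, lt_add_iff_pos_right,
    mul_pos_iff_of_pos_left (by positivity)]
  rfl

lemma norm_sub_conj_pos (hz : z ∈ upperHalf) (hw : w ∈ upperHalf) : 0 < ‖w - conj z‖ :=
  (norm_nonneg _).trans_lt ((mem_upperHalf_iff_norm_sub_lt hz).1 hw)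

lemma sub_conj_ne_zero (hz : z ∈ upperHalf) (hw : w ∈ upperHalf) : w - conj z ≠ 0 :=
  norm_pos_iff.1 (norm_sub_conj_pos hz hw)

lemma pseudoHypDist_nonneg (z w : ℂ) : 0 ≤ pseudoHypDist z w := norm_nonneg _

lemma pseudoHypDist_comm (z w : ℂ) : pseudoHypDist z w = pseudoHypDist w z := by
  have hconj : ‖w - conj z‖ = ‖z - conj w‖ := by
    rw [← Complex.norm_conj, map_sub, Complex.conj_conj, norm_sub_rev]
  rw [pseudoHypDist, pseudoHypDist, norm_div, norm_div, hconj, norm_sub_rev]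

lemma pseudoHypDist_sq (z w : ℂ) :
    pseudoHypDist z w ^ 2 = ‖w - z‖ ^ 2 / (‖w - z‖ ^ 2 + 4 * z.im * w.im) := by
  rw [pseudoHypDist, norm_div, div_pow, norm_sub_conj_sq]

lemma pseudoHypDist_lt_one (hz : z ∈ upperHalf) (hw : w ∈ upperHalf) : pseudoHypDist z w < 1 := by
  rw [pseudoHypDist, norm_div, div_lt_one (norm_sub_conj_pos hz hw)]
  exact (mem_upperHalf_iff_norm_sub_lt hz).1 hw

lemma pseudoHypDist_mul_norm_sub_conj (hz : z ∈ upperHalf) (hw : w ∈ upperHalf) :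
    pseudoHypDist z w * ‖w - conj z‖ = ‖w - z‖ := by
  rw [pseudoHypDist, norm_div, div_mul_cancel₀ _ (norm_sub_conj_pos hz hw).ne']

lemma pseudoHypDist_eq_zero (hz : z ∈ upperHalf) (hw : w ∈ upperHalf) :
    pseudoHypDist z w = 0 ↔ z = w := by
  rw [pseudoHypDist, norm_eq_zero, div_eq_zero_iff, or_iff_left (sub_conj_ne_zero hz hw),
    sub_eq_zero, eq_comm]

lemma norm_sub_conj_le (hz : z ∈ upperHalf) : ‖w - conj z‖ ≤ ‖w - z‖ + 2 * z.im := by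
  have hz' : 0 < z.im := hz
  calc ‖w - conj z‖ = ‖(w - z) + (z - conj z)‖ := by rw [sub_add_sub_cancel]
    _ ≤ ‖w - z‖ + ‖z - conj z‖ := norm_add_le _ _
    _ = ‖w - z‖ + 2 * z.im := by
      rw [Complex.sub_conj, norm_mul, Complex.norm_I, mul_one, Complex.norm_real,
        Real.norm_of_nonneg (by positivity)]

lemma norm_sub_le_of_pseudoHypDist_le (hz : z ∈ upperHalf) (hw : w ∈ upperHalf) (hr : r < 1)
    (h : pseudoHypDist z w ≤ r) : ‖w - z‖ ≤ 2 * r / (1 - r) * z.im := by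
  have hr0 : 0 ≤ r := (pseudoHypDist_nonneg z w).trans h
  have hle : ‖w - z‖ ≤ r * (‖w - z‖ + 2 * z.im) :=
    calc ‖w - z‖ = pseudoHypDist z w * ‖w - conj z‖ :=
          (pseudoHypDist_mul_norm_sub_conj hz hw).symm
      _ ≤ r * (‖w - z‖ + 2 * z.im) := by gcongr; exact norm_sub_conj_le hz
  rw [div_mul_eq_mul_div, le_div_iff₀ (by linarith)]
  linarith

lemma im_le_of_pseudoHypDist_le (hz : z ∈ upperHalf) (hw : w ∈ upperHalf) (hr : r < 1)
    (h : pseudoHypDist z w ≤ r) : w.im ≤ (1 + r) / (1 - r) * z.im := by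
  have hnorm := (Complex.im_le_norm _).trans (norm_sub_le_of_pseudoHypDist_le hz hw hr h)
  have hr' : 1 - r ≠ 0 := (sub_pos.2 hr).ne'
  have hcoef : (1 + r) / (1 - r) = 1 + 2 * r / (1 - r) := by field_simp; ring
  rw [Complex.sub_im] at hnorm
  rw [hcoef]
  linarith

lemma pseudoHypDist_le_norm_sub_div_im (hz : z ∈ upperHalf) (hw : w ∈ upperHalf) :
    pseudoHypDist z w ≤ ‖w - z‖ / z.im := by
  have hz' : 0 < z.im := hz
  have hw' : 0 < w.im := hw
  rw [pseudoHypDist, norm_div]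
  gcongr
  calc z.im ≤ (w - conj z).im := by rw [Complex.sub_im, Complex.conj_im]; linarith
    _ ≤ ‖w - conj z‖ := Complex.im_le_norm _

lemma exists_forall_pseudoHypDist_le {m : ℝ} (hm : 0 < m) (D : ℝ) :
    ∃ r : ℝ, r < 1 ∧ ∀ z w : ℂ, m ≤ z.im → m ≤ w.im → ‖w - z‖ ≤ D → pseudoHypDist z w ≤ r := by
  have hlt : D ^ 2 / (D ^ 2 + 4 * m ^ 2) < 1 := by
    rw [div_lt_one (by positivity)]
    exact lt_add_of_pos_right _ (by positivity)
  refine ⟨√(D ^ 2 / (D ^ 2 + 4 * m ^ 2)), (Real.sqrt_lt' one_pos).2 (by rwa [one_pow]),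
    fun z w hz hw hD => Real.le_sqrt_of_sq_le ?_⟩
  have him : m ^ 2 ≤ z.im * w.im := by rw [sq]; exact mul_le_mul hz hw hm.le (hm.le.trans hz)
  have hD2 : ‖w - z‖ ^ 2 ≤ D ^ 2 := by gcongr
  have hprod : ‖w - z‖ ^ 2 * m ^ 2 ≤ D ^ 2 * (z.im * w.im) := by gcongr
  have him0 : 0 < z.im * w.im := him.trans_lt' (by positivity)
  rw [pseudoHypDist_sq, div_le_div_iff₀ (by rw [mul_assoc]; positivity) (by positivity)]
  linarith

lemma exists_forall_pseudoHypDist_le_of_isCompact {K : Set ℂ} (hK : IsCompact K)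
    (hKU : K ⊆ upperHalf) (hz : z ∈ upperHalf) :
    ∃ r : ℝ, r < 1 ∧ ∀ w ∈ K, pseudoHypDist z w ≤ r := by
  have hcont : ContinuousOn (pseudoHypDist z) K :=
    ((continuousOn_id.sub continuousOn_const).div (continuousOn_id.sub continuousOn_const)
      fun w hw => sub_conj_ne_zero hz (hKU hw)).norm
  exact hK.exists_forall_le' (α := ℝᵒᵈ) hcont fun w hw => pseudoHypDist_lt_one hz (hKU hw)

end PseudoHyperbolic

section SchwarzPick

variable {f : ℂ → ℂ} {z w : ℂ}

/-- The inverse of the Cayley transform `w ↦ (w - z) / (w - conj z)`, which maps the unit disc onto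
the upper half-plane and `0` to `z`. -/
noncomputable def cayleyInv (z ζ : ℂ) : ℂ := (z - conj z * ζ) / (1 - ζ)

lemma one_sub_ne_zero_of_mem_ball {ζ : ℂ} (hζ : ζ ∈ Metric.ball (0 : ℂ) 1) : 1 - ζ ≠ 0 := by
  intro h
  rw [mem_ball_zero_iff, ← sub_eq_zero.1 h, norm_one] at hζ
  exact lt_irrefl _ hζ

lemma differentiableOn_cayleyInv (z : ℂ) :
    DifferentiableOn ℂ (cayleyInv z) (Metric.ball 0 1) :=
  DifferentiableOn.div (by fun_prop) (by fun_prop) fun _ => one_sub_ne_zero_of_mem_ball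

lemma mapsTo_cayleyInv (hz : z ∈ upperHalf) :
    Set.MapsTo (cayleyInv z) (Metric.ball 0 1) upperHalf := by
  intro ζ hζ
  have hne := one_sub_ne_zero_of_mem_ball hζ
  have hsub : cayleyInv z ζ - z = ζ * ((z - conj z) / (1 - ζ)) := by
    rw [cayleyInv]; field_simp; ring
  have hsub_conj : cayleyInv z ζ - conj z = (z - conj z) / (1 - ζ) := by
    rw [cayleyInv]; field_simp; ring
  rw [mem_upperHalf_iff_norm_sub_lt hz, hsub, hsub_conj, norm_mul]
  exact mul_lt_of_lt_one_left (norm_pos_iff.2 (div_ne_zero (sub_conj_ne_zero hz hz) hne))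
    (mem_ball_zero_iff.1 hζ)

lemma cayleyInv_apply_div (hz : z ∈ upperHalf) (hw : w ∈ upperHalf) :
    cayleyInv z ((w - z) / (w - conj z)) = w := by
  have hwz := sub_conj_ne_zero hz hw
  have hzz := sub_conj_ne_zero hz hz
  have hone_sub : 1 - (w - z) / (w - conj z) = (z - conj z) / (w - conj z) := by
    field_simp; ring
  rw [cayleyInv, hone_sub]
  field_simp
  ring

/-- The **Schwarz-Pick lemma** for the upper half-plane. -/
lemma pseudoHypDist_map_le (hf : DifferentiableOn ℂ f upperHalf)
    (hm : Set.MapsTo f upperHalf upperHalf) (hz : z ∈ upperHalf) (hw : w ∈ upperHalf) :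
    pseudoHypDist (f z) (f w) ≤ pseudoHypDist z w := by
  have hmg := mapsTo_cayleyInv hz
  set F : ℂ → ℂ := fun ζ => (f (cayleyInv z ζ) - f z) / (f (cayleyInv z ζ) - conj (f z)) with hF
  have hfg := hf.comp (differentiableOn_cayleyInv z) hmg
  have hFd : DifferentiableOn ℂ F (Metric.ball 0 1) :=
    (hfg.sub_const _).div (hfg.sub_const _) fun ζ hζ => sub_conj_ne_zero (hm hz) (hm (hmg hζ))
  have hFm : Set.MapsTo F (Metric.ball 0 1) (Metric.closedBall 0 1) := fun ζ hζ =>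
    mem_closedBall_zero_iff.2 (pseudoHypDist_lt_one (hm hz) (hm (hmg hζ))).le
  have hF0 : F 0 = 0 := by simp [hF, cayleyInv]
  have hschwarz := Complex.norm_le_norm_of_mapsTo_ball hFd hFm hF0 (pseudoHypDist_lt_one hz hw)
  simp only [hF, cayleyInv_apply_div hz hw] at hschwarz
  exact hschwarz

lemma im_mul_im_mul_norm_sub_conj_sq_le (hf : DifferentiableOn ℂ f upperHalf)
    (hm : Set.MapsTo f upperHalf upperHalf) (hz : z ∈ upperHalf) (hw : w ∈ upperHalf) :
    z.im * w.im * ‖f w - conj (f z)‖ ^ 2 ≤ (f z).im * (f w).im * ‖w - conj z‖ ^ 2 := by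
  have hle := pow_le_pow_left₀ (pseudoHypDist_nonneg _ _) (pseudoHypDist_map_le hf hm hz hw) 2
  rw [pseudoHypDist_sq, pseudoHypDist_sq, ← norm_sub_conj_sq, ← norm_sub_conj_sq,
    div_le_div_iff₀ (pow_pos (norm_sub_conj_pos (hm hz) (hm hw)) 2)
      (pow_pos (norm_sub_conj_pos hz hw) 2), eq_sub_of_add_eq (norm_sub_conj_sq z w).symm,
    eq_sub_of_add_eq (norm_sub_conj_sq (f z) (f w)).symm] at hle
  linarith

lemma norm_map_sub_le (hf : DifferentiableOn ℂ f upperHalf)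
    (hm : ∀ ζ ∈ upperHalf, 0 ≤ (f ζ).im) {r : ℝ} (hz : z ∈ upperHalf) (hw : w ∈ upperHalf)
    (hr : r < 1) (h : pseudoHypDist z w ≤ r) :
    ‖f w - f z‖ ≤ 2 * r / (1 - r) * (f z).im := by
  have hshift : ∀ δ : ℝ, 0 < δ → ‖f w - f z‖ ≤ 2 * r / (1 - r) * ((f z).im + δ) := by
    intro δ hδ
    -- Schwarz-Pick needs values in the open half-plane, hence the upward shift.
    set g : ℂ → ℂ := fun ζ => f ζ + δ * Complex.I with hg
    have hgim : ∀ ζ, (g ζ).im = (f ζ).im + δ := fun ζ => by simp [hg]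
    have hgm : Set.MapsTo g upperHalf upperHalf := fun ζ hζ => by
      change 0 < (g ζ).im
      linarith [hgim ζ, hm ζ hζ]
    have hgle := norm_sub_le_of_pseudoHypDist_le (hgm hz) (hgm hw) hr
      ((pseudoHypDist_map_le (hf.add_const _) hgm hz hw).trans h)
    rwa [hgim, add_sub_add_right_eq_sub] at hgle
  have hlim : Tendsto (fun δ : ℝ => 2 * r / (1 - r) * ((f z).im + δ)) (𝓝[>] 0)
      (𝓝 (2 * r / (1 - r) * ((f z).im + 0))) :=
    ((tendsto_const_nhds.add tendsto_id).const_mul _).mono_left nhdsWithin_le_nhds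
  rw [add_zero] at hlim
  exact ge_of_tendsto hlim (eventually_mem_nhdsWithin.mono hshift)

end SchwarzPick

/-- **Julia's lemma** for a fixed point at infinity with angular derivative `α`. -/
lemma mul_im_le_im_of_tendsto_div {f : ℂ → ℂ} (hf : DifferentiableOn ℂ f upperHalf)
    (hm : Set.MapsTo f upperHalf upperHalf) {α : ℝ}
    (hα : Tendsto (fun t : ℝ => f (t * Complex.I) / (t * Complex.I)) atTop (𝓝 α)) {z : ℂ}
    (hz : z ∈ upperHalf) : α * z.im ≤ (f z).im := by
  have hz' : 0 < z.im := hz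
  have hfz : 0 < (f z).im := hm hz
  rcases le_or_gt α 0 with hα0 | hα0
  · exact (mul_nonpos_of_nonpos_of_nonneg hα0 hz'.le).trans hfz.le
  have hray : Tendsto (fun t : ℝ => f (t * Complex.I) / t) atTop (𝓝 (α * Complex.I)) := by
    refine (hα.mul_const Complex.I).congr fun t => ?_
    rw [div_mul_eq_mul_div, mul_div_mul_right _ _ Complex.I_ne_zero]
  have hinv : Tendsto (fun t : ℝ => (t : ℂ)⁻¹) atTop (𝓝 0) :=
    tendsto_inv₀_cobounded.comp (RCLike.tendsto_ofReal_atTop_cobounded ℂ)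
  have hdiv (c : ℂ) : Tendsto (fun t : ℝ => c / t) atTop (𝓝 0) := by
    simpa only [mul_zero, div_eq_mul_inv] using hinv.const_mul c
  have hscaled : ∀ᶠ t : ℝ in atTop, z.im * ‖f (t * Complex.I) / t - conj (f z) / t‖ ^ 2 ≤
      (f z).im * (f (t * Complex.I) / t).im * ‖Complex.I - conj z / t‖ ^ 2 := by
    filter_upwards [eventually_gt_atTop 0] with t ht
    have htc : (t : ℂ) ≠ 0 := by exact_mod_cast ht.ne'
    have htI : ((t : ℂ) * Complex.I).im = t := by simp
    have hpick := im_mul_im_mul_norm_sub_conj_sq_le hf hm hz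
      (show (t : ℂ) * Complex.I ∈ upperHalf from ht.trans_eq htI.symm)
    have hI : Complex.I - conj z / t = (t * Complex.I - conj z) / t := by field_simp
    rw [htI] at hpick
    rw [hI, ← sub_div, norm_div, norm_div, Complex.norm_real, Real.norm_of_nonneg ht.le,
      Complex.div_ofReal_im]
    field_simp
    linarith
  have hle := le_of_tendsto_of_tendsto (((hray.sub (hdiv _)).norm.pow 2).const_mul z.im)
    ((((Complex.continuous_im.tendsto _).comp hray).const_mul (f z).im).mul
      ((tendsto_const_nhds.sub (hdiv _)).norm.pow 2)) hscaled
  have hle' : α * (α * z.im) ≤ α * (f z).im := by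
    simp only [sub_zero, norm_mul, Complex.norm_real, Real.norm_eq_abs, Complex.norm_I, mul_one,
      sq_abs, Complex.mul_im, Complex.ofReal_re, Complex.I_im, Complex.ofReal_im, Complex.I_re,
      mul_zero, add_zero, one_pow] at hle
    linarith
  exact le_of_mul_le_mul_left hle' hα0

lemma tendsto_ofReal_mul_I_atTop {θ : ℝ} (hθ : 0 < θ) :
    Tendsto (fun t : ℝ => (t : ℂ) * Complex.I) atTop
      (Bornology.cobounded ℂ ⊓ 𝓟 (sectorAtInfty θ)) := by
  refine tendsto_inf.2 ⟨?_, tendsto_principal.2 ?_⟩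
  · rw [← tendsto_norm_atTop_iff_cobounded]
    simpa using tendsto_abs_atTop_atTop
  · filter_upwards [eventually_gt_atTop 0] with t ht
    simpa [sectorAtInfty, Complex.arg_real_mul _ ht] using hθ

/-- A map which is holomorphic and does not decrease imaginary parts on the upper half-plane. By
Julia's lemma parabolic self-maps with Denjoy-Wolff point infinity have this property. Only the
values of `φ` on the upper half-plane matter. -/
structure IsImNondecreasing (φ : ℂ → ℂ) : Prop where
  differentiableOn : DifferentiableOn ℂ φ upperHalf
  im_le_im : ∀ ⦃z⦄, z ∈ upperHalf → z.im ≤ (φ z).im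

lemma IsParabolicSelfMap.isImNondecreasing {φ : ℂ → ℂ} (hφ : IsParabolicSelfMap φ) :
    IsImNondecreasing φ where
  differentiableOn := hφ.differentiableOn
  im_le_im z hz := by
    have hray := (hφ.tendsto_div (Real.pi / 4) (by positivity) (by linarith [Real.pi_pos])).comp
      (tendsto_ofReal_mul_I_atTop (by positivity))
    rw [← one_mul z.im]
    refine mul_im_le_im_of_tendsto_div hφ.differentiableOn hφ.mapsTo ?_ hz
    rwa [Complex.ofReal_one]

namespace IsImNondecreasing

variable {φ : ℂ → ℂ} {z w : ℂ} {r : ℝ}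

lemma mapsTo (hφ : IsImNondecreasing φ) : Set.MapsTo φ upperHalf upperHalf := fun _ hz =>
  lt_of_lt_of_le hz (hφ.im_le_im hz)

lemma iterate (hφ : IsImNondecreasing φ) (n : ℕ) : IsImNondecreasing φ^[n] where
  differentiableOn := hφ.differentiableOn.iterate hφ.mapsTo n
  im_le_im z hz := by
    induction n with
    | zero => exact le_rfl
    | succ n ih =>
      rw [Function.iterate_succ_apply']
      exact ih.trans (hφ.im_le_im (hφ.mapsTo.iterate n hz))

lemma norm_displacement_sub_le (hφ : IsImNondecreasing φ) (hz : z ∈ upperHalf)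
    (hw : w ∈ upperHalf) (hr : r < 1) (h : pseudoHypDist z w ≤ r) :
    ‖(φ w - w) - (φ z - z)‖ ≤ 2 * r / (1 - r) * ((φ z).im - z.im) :=
  norm_map_sub_le (hφ.differentiableOn.sub differentiableOn_id)
    (fun _ hζ => sub_nonneg.2 (hφ.im_le_im hζ)) hz hw hr h

end IsImNondecreasing

section Sequences

variable {X : Type*} [PseudoMetricSpace X] {f : ℕ → X} {y : ℕ → ℝ}

lemma dist_le_sub_of_dist_succ_le (h : ∀ n, dist (f n) (f (n + 1)) ≤ y n - y (n + 1)) {n m : ℕ}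
    (hnm : n ≤ m) : dist (f n) (f m) ≤ y n - y m := by
  induction m, hnm using Nat.le_induction with
  | base => simp
  | succ m _ ih => linarith [dist_triangle (f n) (f m) (f (m + 1)), h m]

lemma cauchySeq_of_dist_succ_le_sub {L : ℝ} (hy : Tendsto y atTop (𝓝 L))
    (h : ∀ n, dist (f n) (f (n + 1)) ≤ y n - y (n + 1)) : CauchySeq f := by
  have hanti : Antitone y := antitone_nat_of_succ_le fun n => sub_nonneg.1 (dist_nonneg.trans (h n))
  refine cauchySeq_of_le_tendsto_0' (fun n => y n - L) (fun n m hnm => ?_)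
    (by simpa only [sub_self] using hy.sub_const L)
  exact (dist_le_sub_of_dist_succ_le h hnm).trans
    (sub_le_sub_left (hanti.le_of_tendsto hy m) _)

/-- Bootstrapping: the bound on the steps is only assumed as long as the sequence stays near its
starting point, but there is not enough variation available to leave that neighbourhood. -/
lemma dist_succ_le_sub_of_dist_le {S : ℝ} (hS : ∀ n, dist (f n) (f (n + 1)) ≤ S)
    (hy : ∀ n, y 0 - y n ≤ 1)
    (h : ∀ n, dist (f 0) (f (n + 1)) ≤ S + 1 → dist (f n) (f (n + 1)) ≤ y n - y (n + 1)) (n : ℕ) :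
    dist (f n) (f (n + 1)) ≤ y n - y (n + 1) := by
  suffices hdist : ∀ n, dist (f 0) (f n) ≤ y 0 - y n from
    h n (by linarith [dist_triangle (f 0) (f n) (f (n + 1)), hdist n, hS n, hy n])
  intro n
  induction n with
  | zero => simp
  | succ n ih =>
    have htri := dist_triangle (f 0) (f n) (f (n + 1))
    linarith [h n (by linarith [hS n, hy n])]

lemma exists_ge_abs_sub_le {x : ℕ → ℝ} (hx : Tendsto x atTop atTop) {B : ℝ}
    (hB : ∀ n, |x (n + 1) - x n| ≤ B) {M : ℕ} {t : ℝ} (ht : x M ≤ t) :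
    ∃ m ≥ M, |t - x m| ≤ B := by
  have hex : ∃ k, t < x (M + k) :=
    (((tendsto_add_atTop_iff_nat M).2 hx).eventually_gt_atTop t).exists.imp fun k hk => by
      rwa [add_comm]
  obtain ⟨k, hk, hmin⟩ : ∃ k, t < x (M + k) ∧ ∀ j < k, x (M + j) ≤ t :=
    ⟨Nat.find hex, Nat.find_spec hex, fun j hj => not_lt.1 (Nat.find_min hex hj)⟩
  cases k with
  | zero => exact absurd ht hk.not_ge
  | succ k =>
    refine ⟨M + k, Nat.le_add_right _ _, ?_⟩
    have hle := hmin k k.lt_succ_self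
    rw [abs_of_nonneg (sub_nonneg.2 hle)]
    exact (sub_le_sub_right hk.le _).trans ((le_abs_self _).trans (hB (M + k)))

lemma nonneg_of_tendsto_sub_succ {x : ℕ → ℝ} (hx : Tendsto x atTop atTop) {L : ℝ}
    (hL : Tendsto (fun n => x (n + 1) - x n) atTop (𝓝 L)) : 0 ≤ L := by
  by_contra! hneg
  obtain ⟨N, hN⟩ := eventually_atTop.1 (hL.eventually (gt_mem_nhds hneg))
  obtain ⟨n, hnN, hn⟩ := ((eventually_ge_atTop N).and (hx.eventually_gt_atTop (x N))).exists
  have hanti : AntitoneOn x (Set.Ici N) :=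
    antitoneOn_nat_Ici_of_succ_le fun k hk => (sub_neg.1 (hN k hk)).le
  exact hn.not_ge (hanti (Set.mem_Ici.2 le_rfl) hnN hnN)

lemma uniformCauchySeqOn_of_dist_le {α : Type*} {F : ℕ → α → X} {K : Set α} {b : ℕ → ℝ}
    (hb : Tendsto b atTop (𝓝 0))
    (h : ∀ᶠ n in atTop, ∀ k, ∀ z ∈ K, dist (F n z) (F (n + k) z) ≤ b n) :
    UniformCauchySeqOn F atTop K := by
  refine Metric.uniformCauchySeqOn_iff.2 fun ε hε => ?_
  obtain ⟨N, hNε, hN⟩ := ((hb.eventually (gt_mem_nhds (half_pos hε))).and h).exists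
  refine ⟨N, fun m hm n hn z hz => ?_⟩
  obtain ⟨j, rfl⟩ := Nat.exists_eq_add_of_le hm
  obtain ⟨k, rfl⟩ := Nat.exists_eq_add_of_le hn
  linarith [dist_triangle_left (F (N + j) z) (F (N + k) z) (F N z), hN j z hz, hN k z hz]

end Sequences

namespace IsBISBS

variable {φ : ℂ → ℂ} {w w' : ℕ → ℂ}

lemma iterate_map (hw : IsBISBS φ w) (n k : ℕ) : φ^[k] (w (n + k)) = w n := by
  induction k with
  | zero => rfl
  | succ k ih => rw [Function.iterate_succ_apply, ← add_assoc, hw.map_succ, ih]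

lemma antitone_im (hw : IsBISBS φ w) (hφ : IsImNondecreasing φ) : Antitone fun n => (w n).im :=
  antitone_nat_of_succ_le fun n => (hφ.im_le_im (hw.mem (n + 1))).trans_eq (by rw [hw.map_succ])

lemma monotone_step (hw : IsBISBS φ w) (hφ : IsImNondecreasing φ) :
    Monotone fun n => pseudoHypDist (w n) (w (n + 1)) :=
  monotone_nat_of_le_succ fun n => by
    simpa only [hw.map_succ] using
      pseudoHypDist_map_le hφ.differentiableOn hφ.mapsTo (hw.mem (n + 1)) (hw.mem (n + 2))

lemma exists_norm_sub_succ_le (hw : IsBISBS φ w) (hφ : IsImNondecreasing φ) :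
    ∃ B : ℝ, ∀ n, ‖w (n + 1) - w n‖ ≤ B := by
  obtain ⟨c, hc, hstep⟩ := hw.bounded_steps
  have hc0 : 0 ≤ c := (pseudoHypDist_nonneg _ _).trans (hstep 0)
  have hC : 0 ≤ 2 * c / (1 - c) := div_nonneg (by positivity) (sub_nonneg.2 hc.le)
  refine ⟨2 * c / (1 - c) * (w 0).im, fun n => ?_⟩
  exact (norm_sub_le_of_pseudoHypDist_le (hw.mem n) (hw.mem (n + 1)) hc (hstep n)).trans
    (mul_le_mul_of_nonneg_left (hw.antitone_im hφ n.zero_le) hC)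

lemma dist_sub_succ_le (hw : IsBISBS φ w) (hw' : IsBISBS φ w') (hφ : IsImNondecreasing φ)
    {n m : ℕ} {r : ℝ} (hr : r < 1) (h : pseudoHypDist (w (n + 1)) (w' (m + 1)) ≤ r) :
    dist (w' m - w n) (w' (m + 1) - w (n + 1)) ≤
      2 * r / (1 - r) * ((w n).im - (w (n + 1)).im) := by
  have hdisp := hφ.norm_displacement_sub_le (hw.mem (n + 1)) (hw'.mem (m + 1)) hr h
  rw [hw.map_succ, hw'.map_succ] at hdisp
  rwa [dist_eq_norm, sub_sub_sub_comm]

end IsBISBS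

lemma eq_mul_translationLength {a s ℓ : ℝ} (ha : 0 ≤ a) (hs : 0 ≤ s) (hℓ : 0 < ℓ)
    (h : a ^ 2 = s ^ 2 / (s ^ 2 + 4 * ℓ ^ 2)) : s = ℓ * translationLength a := by
  have hone_sub : 1 - a ^ 2 = (2 * ℓ) ^ 2 / (s ^ 2 + 4 * ℓ ^ 2) := by
    rw [h]; field_simp; ring
  have hpos : 0 < 1 - a ^ 2 := by rw [hone_sub]; positivity
  have hsq : (s * √(1 - a ^ 2)) ^ 2 = (ℓ * (2 * a)) ^ 2 := by
    rw [mul_pow, Real.sq_sqrt hpos.le, hone_sub, mul_pow ℓ, mul_pow 2 a, h]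
    ring
  rw [translationLength, ← mul_div_assoc, eq_div_iff (Real.sqrt_pos.2 hpos).ne']
  exact (pow_left_inj₀ (by positivity) (by positivity) two_ne_zero).1 hsq

namespace IsNonzeroHeightBISBS

variable {φ : ℂ → ℂ} {w w' : ℕ → ℂ} {a a' ℓ ℓ' : ℝ}

lemma height_le_im (hw : IsNonzeroHeightBISBS φ w a ℓ) (hφ : IsImNondecreasing φ) (n : ℕ) :
    ℓ ≤ (w n).im :=
  (hw.antitone_im hφ).le_of_tendsto hw.tendsto_im n

lemma step_lt_one (hw : IsNonzeroHeightBISBS φ w a ℓ) : a < 1 :=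
  let ⟨_, hc, hstep⟩ := hw.bounded_steps
  (le_of_tendsto' hw.tendsto_step hstep).trans_lt hc

lemma step_nonneg (hw : IsNonzeroHeightBISBS φ w a ℓ) : 0 ≤ a :=
  ge_of_tendsto' hw.tendsto_step fun _ => pseudoHypDist_nonneg _ _

lemma step_pos (hw : IsNonzeroHeightBISBS φ w a ℓ) (hφ : IsImNondecreasing φ) : 0 < a := by
  refine hw.step_nonneg.lt_of_ne fun ha => ?_
  have hstep (n : ℕ) : pseudoHypDist (w n) (w (n + 1)) = 0 :=
    (((hw.monotone_step hφ).ge_of_tendsto hw.tendsto_step n).trans_eq ha.symm).antisymm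
      (pseudoHypDist_nonneg _ _)
  have hconst (n : ℕ) : w n = w 0 := by
    induction n with
    | zero => rfl
    | succ n ih => rw [← (pseudoHypDist_eq_zero (hw.mem n) (hw.mem (n + 1))).1 (hstep n), ih]
  have hnorm := tendsto_norm_cobounded_atTop.comp hw.tendsto_infty
  simp only [Function.comp_def, hconst] at hnorm
  exact not_tendsto_const_atTop _ _ hnorm

lemma translationLength_pos (hw : IsNonzeroHeightBISBS φ w a ℓ) (hφ : IsImNondecreasing φ) :
    0 < translationLength a := by
  have hpos : 0 < 1 - a ^ 2 :=
    sub_pos.2 (pow_lt_one₀ hw.step_nonneg hw.step_lt_one two_ne_zero)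
  exact div_pos (mul_pos two_pos (hw.step_pos hφ)) (Real.sqrt_pos.2 hpos)

lemma tendsto_re (hw : IsNonzeroHeightBISBS φ w a ℓ) :
    Tendsto (fun n => (w n).re) atTop atTop := by
  have hnorm := tendsto_norm_cobounded_atTop.comp hw.tendsto_infty
  have hcos := (Real.continuous_cos.tendsto 0).comp hw.tendsto_arg
  rw [Real.cos_zero] at hcos
  exact (hnorm.atTop_mul_pos one_pos hcos).congr fun n => Complex.norm_mul_cos_arg (w n)

lemma tendsto_sub_succ (hw : IsNonzeroHeightBISBS φ w a ℓ) (hφ : IsImNondecreasing φ) :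
    Tendsto (fun n => w (n + 1) - w n) atTop (𝓝 ((ℓ * translationLength a : ℝ) : ℂ)) := by
  obtain ⟨c, hc, hstep⟩ := hw.bounded_steps
  obtain ⟨L, hL⟩ := cauchySeq_tendsto_of_complete <|
    cauchySeq_of_dist_succ_le_sub (hw.tendsto_im.const_mul (2 * c / (1 - c))) fun n =>
      (hw.dist_sub_succ_le hw.toIsBISBS hφ hc (hstep (n + 1))).trans_eq (mul_sub _ _ _)
  have hL_im : L.im = 0 := by
    refine tendsto_nhds_unique ((Complex.continuous_im.tendsto L).comp hL) ?_
    rw [← sub_self ℓ]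
    exact ((tendsto_add_atTop_iff_nat 1).2 hw.tendsto_im).sub hw.tendsto_im
  have hL_re : 0 ≤ L.re :=
    nonneg_of_tendsto_sub_succ hw.tendsto_re ((Complex.continuous_re.tendsto L).comp hL)
  have hL_eq : L = L.re := Complex.ext rfl hL_im
  have hnorm := hL.norm.pow 2
  have hprod := (hw.tendsto_im.const_mul 4).mul ((tendsto_add_atTop_iff_nat 1).2 hw.tendsto_im)
  have hsq : a ^ 2 = ‖L‖ ^ 2 / (‖L‖ ^ 2 + 4 * ℓ * ℓ) := by
    have hℓ := hw.height_pos
    refine tendsto_nhds_unique (hw.tendsto_step.pow 2) ?_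
    simp only [pseudoHypDist_sq]
    exact hnorm.div (hnorm.add hprod) (by positivity)
  rw [hL_eq, Complex.norm_real, Real.norm_of_nonneg hL_re, mul_assoc, ← sq] at hsq
  rwa [← eq_mul_translationLength hw.step_nonneg hL_re hw.height_pos hsq, ← hL_eq]

lemma tendsto_re_sub_succ (hw : IsNonzeroHeightBISBS φ w a ℓ) (hφ : IsImNondecreasing φ) :
    Tendsto (fun n => (w (n + 1)).re - (w n).re) atTop (𝓝 (ℓ * translationLength a)) :=
  (Complex.continuous_re.tendsto _).comp (hw.tendsto_sub_succ hφ)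

lemma tendsto_re_add_sub (hw : IsNonzeroHeightBISBS φ w a ℓ) (hφ : IsImNondecreasing φ) (j : ℕ) :
    Tendsto (fun n => (w (n + j)).re - (w n).re) atTop (𝓝 (j * (ℓ * translationLength a))) := by
  induction j with
  | zero => simp
  | succ j ih =>
    rw [Nat.cast_succ, add_one_mul]
    refine (ih.add ((tendsto_add_atTop_iff_nat j).2 (hw.tendsto_re_sub_succ hφ))).congr fun n => ?_
    rw [add_comm, sub_add_sub_cancel, add_assoc]

lemma exists_ge_norm_sub_le (hw : IsNonzeroHeightBISBS φ w a ℓ)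
    (hw' : IsNonzeroHeightBISBS φ w' a' ℓ') (hφ : IsImNondecreasing φ) :
    ∃ D : ℝ, ∀ M, ∃ m ≥ M, ∃ N, ‖w' N - w m‖ ≤ D := by
  obtain ⟨B, hB⟩ := hw.exists_norm_sub_succ_le hφ
  refine ⟨B + ((w' 0).im + (w 0).im), fun M => ?_⟩
  obtain ⟨N, hN⟩ := (hw'.tendsto_re.eventually_ge_atTop (w M).re).exists
  obtain ⟨m, hm, hre⟩ :=
    exists_ge_abs_sub_le hw.tendsto_re (fun n => (Complex.abs_re_le_norm _).trans (hB n)) hN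
  refine ⟨m, hm, N, (Complex.norm_le_abs_re_add_abs_im _).trans (add_le_add hre ?_)⟩
  rw [Complex.sub_im, abs_le]
  have hm0 : 0 < (w m).im := hw.mem m
  have hN0 : 0 < (w' N).im := hw'.mem N
  constructor <;> linarith [hw.antitone_im hφ m.zero_le, hw'.antitone_im hφ N.zero_le]

lemma exists_tendsto_add_sub_add (hw : IsNonzeroHeightBISBS φ w a ℓ)
    (hw' : IsNonzeroHeightBISBS φ w' a' ℓ') (hφ : IsImNondecreasing φ) :
    ∃ (N m : ℕ) (L : ℂ), Tendsto (fun k => w' (k + N) - w (k + m)) atTop (𝓝 L) := by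
  obtain ⟨D, hD⟩ := hw.exists_ge_norm_sub_le hw' hφ
  obtain ⟨B, hB⟩ := hw.exists_norm_sub_succ_le hφ
  obtain ⟨B', hB'⟩ := hw'.exists_norm_sub_succ_le hφ
  obtain ⟨r, hr, hdist⟩ := exists_forall_pseudoHypDist_le
    (lt_min hw.height_pos hw'.height_pos) (D + (B' + B + 1))
  have hlim := hw.tendsto_im.const_mul (2 * r / (1 - r))
  obtain ⟨M, hM⟩ := Metric.cauchySeq_iff.1 hlim.cauchySeq 1 one_pos
  obtain ⟨m, hm, N, hmN⟩ := hD M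
  refine ⟨N, m, cauchySeq_tendsto_of_complete <|
    cauchySeq_of_dist_succ_le_sub ((tendsto_add_atTop_iff_nat m).2 hlim) <|
      dist_succ_le_sub_of_dist_le (S := B' + B) (fun k => ?_) (fun k => ?_) fun k hk => ?_⟩
  · rw [dist_eq_norm', sub_sub_sub_comm, add_right_comm k 1 N, add_right_comm k 1 m]
    exact (norm_sub_le _ _).trans (add_le_add (hB' _) (hB _))
  · exact (le_abs_self _).trans (hM _ (by lia) _ (by lia)).le
  · rw [add_right_comm k 1 N, add_right_comm k 1 m] at hk ⊢
    rw [← mul_sub]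
    refine hw.dist_sub_succ_le hw'.toIsBISBS hφ hr (hdist _ _
      ((min_le_left _ _).trans (hw.height_le_im hφ _))
      ((min_le_right _ _).trans (hw'.height_le_im hφ _)) ?_)
    rw [← dist_zero_left]
    refine (dist_triangle _ _ _).trans (add_le_add ?_ hk)
    simpa only [dist_zero_left, zero_add] using hmN

lemma height_mul_translationLength_eq (hw : IsNonzeroHeightBISBS φ w a ℓ)
    (hw' : IsNonzeroHeightBISBS φ w' a' ℓ') (hφ : IsImNondecreasing φ) :
    ℓ * translationLength a = ℓ' * translationLength a' := by
  obtain ⟨N, m, L, hL⟩ := hw.exists_tendsto_add_sub_add hw' hφ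
  have hzero := ((tendsto_add_atTop_iff_nat 1).2 hL).sub hL
  have hdiff := ((tendsto_add_atTop_iff_nat N).2 (hw'.tendsto_sub_succ hφ)).sub
    ((tendsto_add_atTop_iff_nat m).2 (hw.tendsto_sub_succ hφ))
  have heq := tendsto_nhds_unique hzero (hdiff.congr fun k => by
    rw [sub_sub_sub_comm, add_right_comm k N 1, add_right_comm k m 1])
  rw [sub_self, eq_comm, sub_eq_zero, Complex.ofReal_inj] at heq
  exact heq.symm

lemma exists_tendsto_re_sub_re (hw : IsNonzeroHeightBISBS φ w a ℓ)
    (hw' : IsNonzeroHeightBISBS φ w' a' ℓ') (hφ : IsImNondecreasing φ) :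
    ∃ c : ℝ, Tendsto (fun n => (w n).re - (w' n).re) atTop (𝓝 c) := by
  obtain ⟨N, m, L, hL⟩ := hw.exists_tendsto_add_sub_add hw' hφ
  refine ⟨_, (((hw'.tendsto_re_add_sub hφ N).sub (hw.tendsto_re_add_sub hφ m)).sub
    ((Complex.continuous_re.tendsto L).comp hL)).congr fun n => ?_⟩
  rw [Function.comp_apply, Complex.sub_re]
  ring

end IsNonzeroHeightBISBS

section AffineAt

variable {p z w : ℂ}

lemma affineAt_I (p : ℂ) : affineAt p Complex.I = p := Complex.re_add_im p

lemma affineAt_im (p z : ℂ) : (affineAt p z).im = p.im * z.im := by simp [affineAt]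

lemma mapsTo_affineAt (hp : p ∈ upperHalf) : Set.MapsTo (affineAt p) upperHalf upperHalf :=
  fun z hz => (mul_pos hp hz).trans_eq (affineAt_im p z).symm

lemma differentiable_affineAt (p : ℂ) : Differentiable ℂ (affineAt p) := by
  unfold affineAt
  fun_prop

lemma affineAt_sub_self (p z : ℂ) : affineAt p z - p = p.im * (z - Complex.I) := by
  rw [affineAt]
  linear_combination Complex.re_add_im p

lemma pseudoHypDist_self_affineAt (hp : p ∈ upperHalf) (z : ℂ) :
    pseudoHypDist p (affineAt p z) = pseudoHypDist Complex.I z := by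
  have hp' : (p.im : ℂ) ≠ 0 := Complex.ofReal_ne_zero.2 (ne_of_gt hp)
  have hconj : affineAt p z - conj p = p.im * (z - conj Complex.I) := by
    apply Complex.ext <;> simp [affineAt, mul_add]
  rw [pseudoHypDist, pseudoHypDist, affineAt_sub_self, hconj, mul_div_mul_left _ _ hp']

end AffineAt

/-- The iterates `φₙ ∘ τₙ` whose limit is the conjugation attached to `w`. -/
noncomputable def normalizedIterate (φ : ℂ → ℂ) (w : ℕ → ℂ) (n : ℕ) (z : ℂ) : ℂ :=
  φ^[n] (affineAt (w n) z)

lemma I_mem_upperHalf : Complex.I ∈ upperHalf := by simp [upperHalf]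

lemma ofReal_mul_add_ofReal_mem_upperHalf {k : ℝ} (hk : 0 < k) {z : ℂ} (hz : z ∈ upperHalf)
    (t : ℝ) : (k : ℂ) * z + t ∈ upperHalf :=
  (mul_pos hk hz).trans_eq (by simp)

namespace IsBISBS

variable {φ ψ : ℂ → ℂ} {w : ℕ → ℂ} {z : ℂ} {r : ℝ}

lemma norm_iterate_affineAt_sub_le (hw : IsBISBS φ w) (hφ : IsImNondecreasing φ)
    (hz : z ∈ upperHalf) (hr : r < 1) (hzr : pseudoHypDist Complex.I z ≤ r) (n k : ℕ) :
    ‖φ^[k] (affineAt (w (n + k)) z) - affineAt (w n) z‖ ≤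
      4 * r / (1 - r) * ((w n).im - (w (n + k)).im) := by
  set p := w (n + k)
  set u := affineAt p z
  have hp : p ∈ upperHalf := hw.mem (n + k)
  have him : p.im ≤ (w n).im := hw.antitone_im hφ (Nat.le_add_right n k)
  have hdisp : ‖(φ^[k] u - u) - (w n - p)‖ ≤ 2 * r / (1 - r) * ((w n).im - p.im) := by
    simpa only [p, hw.iterate_map n k] using (hφ.iterate k).norm_displacement_sub_le hp
      (mapsTo_affineAt hp hz) hr ((pseudoHypDist_self_affineAt hp z).trans_le hzr)
  have haffine : ‖(u - p) - (affineAt (w n) z - w n)‖ ≤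
      2 * r / (1 - r) * ((w n).im - p.im) := by
    have hzI := norm_sub_le_of_pseudoHypDist_le I_mem_upperHalf hz hr hzr
    rw [Complex.I_im, mul_one] at hzI
    rw [affineAt_sub_self, affineAt_sub_self, ← sub_mul, norm_mul, ← Complex.ofReal_sub,
      Complex.norm_real, Real.norm_eq_abs, abs_sub_comm, abs_of_nonneg (sub_nonneg.2 him), mul_comm]
    exact mul_le_mul_of_nonneg_right hzI (sub_nonneg.2 him)
  calc ‖φ^[k] u - affineAt (w n) z‖
      = ‖((φ^[k] u - u) - (w n - p)) + ((u - p) - (affineAt (w n) z - w n))‖ := by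
        congr 1; ring
    _ ≤ _ := (norm_add_le _ _).trans (add_le_add hdisp haffine)
    _ = 4 * r / (1 - r) * ((w n).im - p.im) := by ring

lemma normalizedIterate_im_le (hw : IsBISBS φ w) (hφ : IsImNondecreasing φ)
    (hz : z ∈ upperHalf) (hr : r < 1) (hzr : pseudoHypDist Complex.I z ≤ r) (n : ℕ) :
    (normalizedIterate φ w n z).im ≤ (1 + r) / (1 - r) * (w 0).im := by
  have hu := mapsTo_affineAt (hw.mem n) hz
  refine im_le_of_pseudoHypDist_le (hw.mem 0) ((hφ.iterate n).mapsTo hu) hr ?_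
  have hpick := pseudoHypDist_map_le (hφ.iterate n).differentiableOn (hφ.iterate n).mapsTo
    (hw.mem n) hu
  have hn : φ^[n] (w n) = w 0 := by simpa only [zero_add] using hw.iterate_map 0 n
  rw [hn, pseudoHypDist_self_affineAt (hw.mem n)] at hpick
  exact hpick.trans hzr

lemma differentiableOn_normalizedIterate (hw : IsBISBS φ w) (hφ : IsImNondecreasing φ) (n : ℕ) :
    DifferentiableOn ℂ (normalizedIterate φ w n) upperHalf :=
  (hφ.iterate n).differentiableOn.comp (differentiable_affineAt _).differentiableOn
    (mapsTo_affineAt (hw.mem n))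

lemma differentiableOn_of_tendsto (hw : IsBISBS φ w) (hφ : IsImNondecreasing φ)
    (hψ : TendstoLocallyUniformlyOn (normalizedIterate φ w) ψ atTop upperHalf) :
    DifferentiableOn ℂ ψ upperHalf :=
  hψ.differentiableOn (.of_forall (hw.differentiableOn_normalizedIterate hφ)) isOpen_upperHalf

end IsBISBS

namespace IsNonzeroHeightBISBS

variable {φ ψ ψ' : ℂ → ℂ} {w w' : ℕ → ℂ} {a a' ℓ ℓ' : ℝ} {z : ℂ} {r : ℝ}

lemma exists_pseudoHypDist_iterate_affineAt_le (hw : IsNonzeroHeightBISBS φ w a ℓ)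
    (hφ : IsImNondecreasing φ) (hr : r < 1) :
    ∃ C : ℝ, ∀ z ∈ upperHalf, pseudoHypDist Complex.I z ≤ r → ∀ n k,
      pseudoHypDist (affineAt (w n) z) (φ^[k] (affineAt (w (n + k)) z)) ≤ C * ((w n).im - ℓ) := by
  refine ⟨4 * r / (1 - r) / (ℓ * ((1 - r) / (1 + r))), fun z hz hzr n k => ?_⟩
  have hℓ := hw.height_pos
  have hr0 : 0 ≤ r := (pseudoHypDist_nonneg _ _).trans hzr
  have hr1 : 0 < 1 - r := sub_pos.2 hr
  have him : ℓ * ((1 - r) / (1 + r)) ≤ (affineAt (w n) z).im := by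
    have hI := im_le_of_pseudoHypDist_le hz I_mem_upperHalf hr
      ((pseudoHypDist_comm _ _).trans_le hzr)
    rw [Complex.I_im, div_mul_eq_mul_div, le_div_iff₀ hr1, one_mul, mul_comm] at hI
    rw [affineAt_im]
    exact mul_le_mul (hw.height_le_im hφ n) ((div_le_iff₀ (by positivity)).2 hI)
      (by positivity) (le_of_lt (hw.mem n))
  have hnorm := hw.norm_iterate_affineAt_sub_le hφ hz hr hzr n k
  calc _ ≤ ‖φ^[k] (affineAt (w (n + k)) z) - affineAt (w n) z‖ / (affineAt (w n) z).im :=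
        pseudoHypDist_le_norm_sub_div_im (mapsTo_affineAt (hw.mem n) hz)
          ((hφ.iterate k).mapsTo (mapsTo_affineAt (hw.mem _) hz))
    _ ≤ 4 * r / (1 - r) * ((w n).im - ℓ) / (ℓ * ((1 - r) / (1 + r))) := by
        gcongr
        · exact mul_nonneg (by positivity) (sub_nonneg.2 (hw.height_le_im hφ n))
        · exact hnorm.trans (by gcongr; exact hw.height_le_im hφ _)
    _ = _ := by ring

lemma uniformCauchySeqOn_normalizedIterate (hw : IsNonzeroHeightBISBS φ w a ℓ)
    (hφ : IsImNondecreasing φ) {K : Set ℂ} (hK : IsCompact K) (hKU : K ⊆ upperHalf) :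
    UniformCauchySeqOn (normalizedIterate φ w) atTop K := by
  obtain ⟨r, hr, hKr⟩ := exists_forall_pseudoHypDist_le_of_isCompact hK hKU I_mem_upperHalf
  obtain ⟨C, hC⟩ := hw.exists_pseudoHypDist_iterate_affineAt_le hφ hr
  set δ : ℕ → ℝ := fun n => C * ((w n).im - ℓ)
  have hδ : Tendsto δ atTop (𝓝 0) := by
    simpa only [sub_self, mul_zero] using (hw.tendsto_im.sub_const ℓ).const_mul C
  have hb : Tendsto (fun n => 2 * δ n / (1 - δ n) * ((1 + r) / (1 - r) * (w 0).im)) atTop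
      (𝓝 0) := by
    simpa only [Pi.div_apply, mul_zero, sub_zero, zero_div, zero_mul] using
      ((hδ.const_mul 2).div (hδ.const_sub 1) (by norm_num)).mul_const
        ((1 + r) / (1 - r) * (w 0).im)
  refine uniformCauchySeqOn_of_dist_le hb ?_
  filter_upwards [hδ.eventually (gt_mem_nhds one_pos)] with n hn k z hz
  have hu := mapsTo_affineAt (hw.mem n) (hKU hz)
  have hv := (hφ.iterate k).mapsTo (mapsTo_affineAt (hw.mem (n + k)) (hKU hz))
  have hδz := hC z (hKU hz) (hKr z hz) n k
  have hδ0 : 0 ≤ δ n := (pseudoHypDist_nonneg _ _).trans hδz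
  have hle := norm_map_sub_le (hφ.iterate n).differentiableOn
    (fun ζ hζ => le_of_lt ((hφ.iterate n).mapsTo hζ)) hu hv hn hδz
  rw [← Function.iterate_add_apply, ← dist_eq_norm'] at hle
  exact hle.trans (mul_le_mul_of_nonneg_left
    (hw.normalizedIterate_im_le hφ (hKU hz) hr (hKr z hz) n)
    (div_nonneg (by positivity) (sub_nonneg.2 hn.le)))

lemma exists_tendstoLocallyUniformlyOn (hw : IsNonzeroHeightBISBS φ w a ℓ)
    (hφ : IsImNondecreasing φ) :
    ∃ ψ, TendstoLocallyUniformlyOn (normalizedIterate φ w) ψ atTop upperHalf := by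
  refine ⟨fun z => limUnder atTop fun n => normalizedIterate φ w n z,
    (tendstoLocallyUniformlyOn_iff_forall_isCompact isOpen_upperHalf).2 fun K hKU hK => ?_⟩
  have hcauchy := hw.uniformCauchySeqOn_normalizedIterate hφ hK hKU
  exact hcauchy.tendstoUniformlyOn_of_tendsto fun z hz => (hcauchy.cauchySeq hz).tendsto_limUnder

lemma mapsTo_of_tendsto (hw : IsNonzeroHeightBISBS φ w a ℓ) (hφ : IsImNondecreasing φ)
    (hψ : TendstoLocallyUniformlyOn (normalizedIterate φ w) ψ atTop upperHalf) :
    Set.MapsTo ψ upperHalf upperHalf := by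
  intro z hz
  have hz' : 0 < z.im := hz
  refine (mul_pos hw.height_pos hz').trans_le <|
    ge_of_tendsto' ((Complex.continuous_im.tendsto _).comp (hψ.tendsto_at hz)) fun n => ?_
  calc ℓ * z.im ≤ (w n).im * z.im := by gcongr; exact hw.height_le_im hφ n
    _ = (affineAt (w n) z).im := (affineAt_im _ _).symm
    _ ≤ (normalizedIterate φ w n z).im := (hφ.iterate n).im_le_im (mapsTo_affineAt (hw.mem n) hz)

lemma tendsto_iterate_affineAt (hw : IsNonzeroHeightBISBS φ w a ℓ) (hφ : IsImNondecreasing φ)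
    (hψ : TendstoLocallyUniformlyOn (normalizedIterate φ w) ψ atTop upperHalf)
    {p : ℕ → ℂ} {y c : ℝ} (hy : 0 < y) (him : Tendsto (fun n => (p n).im) atTop (𝓝 y))
    (hre : Tendsto (fun n => (p n).re - (w n).re) atTop (𝓝 c)) (hz : z ∈ upperHalf) :
    Tendsto (fun n => φ^[n] (affineAt (p n) z)) atTop
      (𝓝 (ψ (((y / ℓ : ℝ) : ℂ) * z + ((c / ℓ : ℝ) : ℂ)))) := by
  set ζ : ℕ → ℂ := fun n =>
    (((p n).im / (w n).im : ℝ) : ℂ) * z + ((((p n).re - (w n).re) / (w n).im : ℝ) : ℂ)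
  have hmem := ofReal_mul_add_ofReal_mem_upperHalf (div_pos hy hw.height_pos) hz (c / ℓ)
  have hζ : Tendsto ζ atTop (𝓝[upperHalf] (((y / ℓ : ℝ) : ℂ) * z + ((c / ℓ : ℝ) : ℂ))) := by
    rw [isOpen_upperHalf.nhdsWithin_eq hmem]
    have hℓ := hw.height_pos.ne'
    exact (((him.div hw.tendsto_im hℓ).ofReal).mul_const z).add
      ((hre.div hw.tendsto_im hℓ).ofReal)
  refine (hψ.tendsto_comp ((hw.differentiableOn_of_tendsto hφ hψ).continuousOn _ hmem) hmem
    hζ).congr fun n => ?_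
  have hw_im : ((w n).im : ℂ) ≠ 0 := Complex.ofReal_ne_zero.2 (ne_of_gt (hw.mem n))
  have haffine : affineAt (w n) (ζ n) = affineAt (p n) z := by
    simp only [ζ, affineAt, Complex.ofReal_div, Complex.ofReal_sub]
    field_simp
    ring
  rw [normalizedIterate, haffine]

lemma map_apply_add_eq (hw : IsNonzeroHeightBISBS φ w a ℓ) (hφ : IsImNondecreasing φ)
    (hψ : TendstoLocallyUniformlyOn (normalizedIterate φ w) ψ atTop upperHalf)
    (hz : z ∈ upperHalf) : φ (ψ (z + translationLength a)) = ψ z := by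
  have hlim := hw.tendsto_iterate_affineAt hφ hψ hw.height_pos
    ((tendsto_add_atTop_iff_nat 1).2 hw.tendsto_im) (hw.tendsto_re_sub_succ hφ) hz
  rw [div_self hw.height_pos.ne', mul_div_cancel_left₀ _ hw.height_pos.ne', Complex.ofReal_one,
    one_mul] at hlim
  have hmem : z + translationLength a ∈ upperHalf := by simpa [upperHalf] using hz
  have hφc : ContinuousAt φ (ψ (z + translationLength a)) :=
    (hφ.differentiableOn.differentiableAt
      (isOpen_upperHalf.mem_nhds (hw.mapsTo_of_tendsto hφ hψ hmem))).continuousAt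
  refine tendsto_nhds_unique ((hφc.tendsto.comp hlim).congr fun n => ?_)
    ((tendsto_add_atTop_iff_nat 1).2 (hψ.tendsto_at hz))
  rw [normalizedIterate, Function.iterate_succ_apply', Function.comp_apply]

lemma exists_isConjugation (hw : IsNonzeroHeightBISBS φ w a ℓ) (hφ : IsImNondecreasing φ) :
    ∃ ψ, IsConjugation φ w (translationLength a) ψ := by
  obtain ⟨ψ, hψ⟩ := hw.exists_tendstoLocallyUniformlyOn hφ
  refine ⟨ψ, hw.differentiableOn_of_tendsto hφ hψ, hw.mapsTo_of_tendsto hφ hψ,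
    (tendstoLocallyUniformlyOn_iff_forall_isCompact isOpen_upperHalf).1 hψ, fun z hz => ?_⟩
  have hmem : z - translationLength a ∈ upperHalf := by simpa [upperHalf] using hz
  rw [← hw.map_apply_add_eq hφ hψ hmem, sub_add_cancel]

lemma apply_I_add_nat_mul_eq (hw : IsNonzeroHeightBISBS φ w a ℓ) (hφ : IsImNondecreasing φ)
    (hψ : TendstoLocallyUniformlyOn (normalizedIterate φ w) ψ atTop upperHalf) (n : ℕ) :
    ψ (Complex.I + n * translationLength a) = w n := by
  have hlim := hw.tendsto_iterate_affineAt hφ hψ hw.height_pos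
    ((tendsto_add_atTop_iff_nat n).2 hw.tendsto_im) (hw.tendsto_re_add_sub hφ n) I_mem_upperHalf
  rw [div_self hw.height_pos.ne', mul_left_comm, mul_div_cancel_left₀ _ hw.height_pos.ne',
    Complex.ofReal_one, one_mul, Complex.ofReal_mul, Complex.ofReal_natCast] at hlim
  refine tendsto_nhds_unique hlim (tendsto_const_nhds.congr fun k => ?_)
  rw [affineAt_I, add_comm, hw.iterate_map]

lemma apply_ofReal_mul_add_eq (hw : IsNonzeroHeightBISBS φ w a ℓ)
    (hw' : IsNonzeroHeightBISBS φ w' a' ℓ') (hφ : IsImNondecreasing φ)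
    (hψ : TendstoLocallyUniformlyOn (normalizedIterate φ w) ψ atTop upperHalf)
    (hψ' : TendstoLocallyUniformlyOn (normalizedIterate φ w') ψ' atTop upperHalf) {c : ℝ}
    (hc : Tendsto (fun n => (w n).re - (w' n).re) atTop (𝓝 c)) (hz : z ∈ upperHalf) :
    ψ' (((translationLength a' / translationLength a : ℝ) : ℂ) * z + ((c / ℓ' : ℝ) : ℂ)) =
      ψ z := by
  have hratio : ℓ / ℓ' = translationLength a' / translationLength a := by
    rw [div_eq_div_iff hw'.height_pos.ne' (hw.translationLength_pos hφ).ne',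
      hw.height_mul_translationLength_eq hw' hφ, mul_comm]
  rw [← hratio]
  exact tendsto_nhds_unique
    (hw'.tendsto_iterate_affineAt hφ hψ' hw.height_pos hw.tendsto_im hc hz) (hψ.tendsto_at hz)

lemma eq_apply_ofReal_mul_I_sub_add (hw : IsNonzeroHeightBISBS φ w a ℓ)
    (hw' : IsNonzeroHeightBISBS φ w' a' ℓ') (hφ : IsImNondecreasing φ)
    (hψ : TendstoLocallyUniformlyOn (normalizedIterate φ w) ψ atTop upperHalf)
    (hψ' : TendstoLocallyUniformlyOn (normalizedIterate φ w') ψ' atTop upperHalf) {c : ℝ}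
    (hc : Tendsto (fun n => (w n).re - (w' n).re) atTop (𝓝 c)) (n : ℕ) :
    w' n = ψ (((translationLength a / translationLength a' : ℝ) : ℂ) *
      (Complex.I - ((c / ℓ' : ℝ) : ℂ)) + n * translationLength a) := by
  have hb := hw.translationLength_pos hφ
  have hb' := hw'.translationLength_pos hφ
  rw [← hw'.apply_I_add_nat_mul_eq hφ hψ' n, ← hw.apply_ofReal_mul_add_eq hw' hφ hψ hψ' hc]
  · have hbc : (translationLength a : ℂ) ≠ 0 := Complex.ofReal_ne_zero.2 hb.ne'
    have hbc' : (translationLength a' : ℂ) ≠ 0 := Complex.ofReal_ne_zero.2 hb'.ne'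
    congr 1
    push_cast
    field_simp
    ring
  · convert ofReal_mul_add_ofReal_mem_upperHalf (div_pos hb hb') I_mem_upperHalf
      (n * translationLength a - translationLength a / translationLength a' * (c / ℓ')) using 1
    push_cast
    ring

end IsNonzeroHeightBISBS

lemma IsConjugation.tendstoLocallyUniformlyOn {φ ψ : ℂ → ℂ} {w : ℕ → ℂ} {b : ℝ}
    (hψ : IsConjugation φ w b ψ) :
    TendstoLocallyUniformlyOn (normalizedIterate φ w) ψ atTop upperHalf :=
  (tendstoLocallyUniformlyOn_iff_forall_isCompact isOpen_upperHalf).2 hψ.tendsto_compact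

theorem theorem1p13 (φ : ℂ → ℂ) (hφ : IsParabolicSelfMap φ)
    (w w' : ℕ → ℂ) (a a' ℓ ℓ' : ℝ)
    (hw : IsNonzeroHeightBISBS φ w a ℓ) (hw' : IsNonzeroHeightBISBS φ w' a' ℓ')
    (b₀ b₀' : ℝ) (hb₀ : b₀ = translationLength a) (hb₀' : b₀' = translationLength a') :
    a < 1 ∧ a' < 1 ∧ 0 < b₀ ∧ 0 < b₀' ∧
    (∃ ψ ψ' : ℂ → ℂ, IsConjugation φ w b₀ ψ ∧ IsConjugation φ w' b₀' ψ' ∧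
      ∃ b₁ : ℝ,
        (∀ z ∈ upperHalf, ψ' (((b₀' / b₀ : ℝ) : ℂ) * z + (b₁ : ℂ)) = ψ z) ∧
        (∀ n : ℕ, w' n =
          ψ (((b₀ / b₀' : ℝ) : ℂ) * (Complex.I - (b₁ : ℂ)) + (n : ℂ) * (b₀ : ℂ)))) ∧
    Tendsto (fun n => (w (n + 1)).re - (w n).re) atTop (𝓝 (ℓ * b₀)) ∧
    Tendsto (fun n => (w' (n + 1)).re - (w' n).re) atTop (𝓝 (ℓ' * b₀')) ∧
    ℓ * b₀ = ℓ' * b₀' := by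
  subst hb₀ hb₀'
  have hφ' := hφ.isImNondecreasing
  obtain ⟨ψ, hψ⟩ := hw.exists_isConjugation hφ'
  obtain ⟨ψ', hψ'⟩ := hw'.exists_isConjugation hφ'
  have hlim := hψ.tendstoLocallyUniformlyOn
  have hlim' := hψ'.tendstoLocallyUniformlyOn
  obtain ⟨c, hc⟩ := hw.exists_tendsto_re_sub_re hw' hφ'
  exact ⟨hw.step_lt_one, hw'.step_lt_one, hw.translationLength_pos hφ',
    hw'.translationLength_pos hφ',
    ⟨ψ, ψ', hψ, hψ', c / ℓ',
      fun _ hz => hw.apply_ofReal_mul_add_eq hw' hφ' hlim hlim' hc hz,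
      hw.eq_apply_ofReal_mul_I_sub_add hw' hφ' hlim hlim' hc⟩,
    hw.tendsto_re_sub_succ hφ', hw'.tendsto_re_sub_succ hφ',
    hw.height_mul_translationLength_eq hw' hφ'⟩
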